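/- An additively separable hedonic game (ASHG) consists of a finite set $N$ of players and values $v_i(j)$ for $i,j\in N$. Player $i$ has utility $\sum_{j\in S\setminus\{i\}} v_i(j)$ in a coalition $S\ni i$ and weakly (strictly) prefers $S$ to $T$ if her utility in $S$ is at least (greater than) that in $T$. Preferences are strict if $v_i(j)\neq 0$ for all $i\neq j$. For a partition $\pi$ of $N$ into coalitions, $\pi(i)$ is the coalition containing $i$. A partition $\pi$ is Pareto optimal if there is no partition $\pi'$ such that every player $i$ weakly prefers $\pi'(i)$ to $\pi(i)$ and some player $j$ strictly prefers $\pi'(j)$ to $\pi(j)$. Serial dictatorship starts with all players remaining; as long as players remain, an arbitrary remaining player $d$ (the dictator) forms a coalition with all remaining players $j$ with $v_d(j)>0$, and the members of this coalition are removed. **Theorem.** (1) In every ASHG with real values and strict preferences, every partition that results from serial dictatorship, for any choice of the dictators, is Pareto optimal. (2) For ASHGs with strict preferences, a Pareto optimal partition can be computed in polynomial time: there is a Turing machine that, given an ASHG with player set $\{0,\dots,n-1\}$, rational values and strict preferences (written as the matrix of values $v_i(j)$, with numerators and denominators in binary), outputs in time polynomial in the length of the input a Pareto optimal partition (written as the list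 of its coalitions in the order of their least members, each coalition as its characteristic bit vector), and this partition is an outcome of serial dictatorship. -/

import Mathlib

/-- An additively separable hedonic game with player set `N`: `value i j` is the value that
player `i` assigns to player `j`. The diagonal values `value i i` play no role. -/
structure ASHG (N R : Type*) where
  value : N → N → R

namespace ASHG

variable {N R : Type*} [DecidableEq N] [AddCommMonoid R] [LinearOrder R]

/-- The utility of player `i` in a coalition `S` containing `i`. -/
def utility (G : ASHG N R) (i : N) (S : Finset N) : R :=
  ∑ j ∈ S \ {i}, G.value i j

/-- Player `i` weakly prefers the coalition `S` to the coalition `T`. -/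
def WeakPref (G : ASHG N R) (i : N) (S T : Finset N) : Prop :=
  G.utility i S ≥ G.utility i T

/-- Player `i` strictly prefers the coalition `S` to the coalition `T`. -/
def StrictPref (G : ASHG N R) (i : N) (S T : Finset N) : Prop :=
  G.WeakPref i S T ∧ ¬ G.WeakPref i T S

/-- The preference profile is strict: no player assigns value zero to another player. -/
def IsStrict (G : ASHG N R) : Prop :=
  ∀ i j : N, i ≠ j → G.value i j ≠ 0

/-- `π'` Pareto dominates `π`; here `π.part i` is the coalition of `π` that contains `i`. -/
def ParetoDominates [Fintype N] (G : ASHG N R)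
    (π' π : Finpartition (Finset.univ : Finset N)) : Prop :=
  (∀ i, G.WeakPref i (π'.part i) (π.part i)) ∧ ∃ j, G.StrictPref j (π'.part j) (π.part j)

def IsParetoOptimal [Fintype N] (G : ASHG N R)
    (π : Finpartition (Finset.univ : Finset N)) : Prop :=
  ¬ ∃ π' : Finpartition (Finset.univ : Finset N), G.ParetoDominates π' π

/-- The coalition formed by the dictator `d` when the players in `A` remain: `d` together with
all remaining players whom `d` strictly likes. -/
def dictatorCoalition (G : ASHG N R) (A : Finset N) (d : N) : Finset N :=
  insert d (A.filter fun j => 0 < G.value d j)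

/-- `SerialDictatorship G A L`: starting with the set `A` of remaining players, some run of serial
dictatorship (with arbitrary choices of the dictators) forms the coalitions in the list `L`, in
this order. -/
inductive SerialDictatorship (G : ASHG N R) : Finset N → List (Finset N) → Prop
  | done : SerialDictatorship G ∅ []
  | step (A : Finset N) (d : N) (L : List (Finset N)) (hd : d ∈ A)
      (h : SerialDictatorship G (A \ G.dictatorCoalition A d) L) :
      SerialDictatorship G A (G.dictatorCoalition A d :: L)

/-- The partition `π` is the outcome of some run of serial dictatorship on all players. -/
def IsSerialDictatorshipOutcome [Fintype N] (G : ASHG N R)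
    (π : Finpartition (Finset.univ : Finset N)) : Prop :=
  ∃ L : List (Finset N), G.SerialDictatorship Finset.univ L ∧ L.toFinset = π.parts

end ASHG

/-- Problem instances: games with players `0, …, n - 1`, rational values, and strict
preferences. -/
structure StrictGame where
  n : ℕ
  game : ASHG (Fin n) ℚ
  strict : game.IsStrict

/-- The alphabet in which games and partitions are written. -/
inductive GameSymbol
  | bit (b : Bool)
  | minus
  | slash
  | comma
  | semicolon
  deriving DecidableEq, Fintype

/-- Natural numbers in binary (least significant bit first, `0` is the empty word). -/
def encodeBinary (k : ℕ) : List GameSymbol :=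
  (Computability.encodeNat k).map GameSymbol.bit

/-- A rational number: optional minus sign, numerator and denominator in lowest terms. -/
def encodeRat (q : ℚ) : List GameSymbol :=
  (if q < 0 then [GameSymbol.minus] else []) ++
    (encodeBinary q.num.natAbs ++ (GameSymbol.slash :: encodeBinary q.den))

/-- The value matrix, row by row: each entry is followed by a comma, each row by a semicolon. -/
def encodeGame (I : StrictGame) : List GameSymbol :=
  (List.finRange I.n).flatMap fun i =>
    ((List.finRange I.n).flatMap fun j => encodeRat (I.game.value i j) ++ [GameSymbol.comma]) ++
      [GameSymbol.semicolon]

/-- The list of the coalitions of a partition of `{0, …, n - 1}`, in the order of their least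
members; each coalition is written as its characteristic bit vector followed by a semicolon. -/
def encodePartition (P : Σ n : ℕ, Finpartition (Finset.univ : Finset (Fin n))) : List GameSymbol :=
  ((List.finRange P.1).filter fun i => ∀ j ∈ P.2.part i, i ≤ j).flatMap fun i =>
    (List.finRange P.1).map (fun j => GameSymbol.bit (decide (j ∈ P.2.part i))) ++ [GameSymbol.semicolon]

/-! The encodings are faithful: a game and a partition can be recovered from their codes. -/

theorem terminator_cancel {α : Type*} {t : α} : ∀ {a b x y : List α}, t ∉ a → t ∉ b →
    a ++ t :: x = b ++ t :: y → a = b ∧ x = y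
  | [], [], x, y, _, _, h => by simpa using h
  | [], c :: b, x, y, _, hb, h => by simp_all
  | c :: a, [], x, y, ha, _, h => by simp_all
  | c :: a, d :: b, x, y, ha, hb, h => by
      simp only [List.cons_append, List.cons.injEq] at h
      have := terminator_cancel (fun h' => ha (by simp [h'])) (fun h' => hb (by simp [h'])) h.2
      exact ⟨by rw [h.1, this.1], this.2⟩

theorem flatMap_terminator_cancel {α β γ : Type*} {t : α} {g : β → List α} {k : γ → List α}
    (hg : ∀ b, t ∉ g b) (hk : ∀ c, t ∉ k c) : ∀ {L : List β} {M : List γ},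
    (L.flatMap fun b => g b ++ [t]) = (M.flatMap fun c => k c ++ [t]) → L.map g = M.map k
  | [], [], _ => rfl
  | [], c :: M, h => by simp at h
  | b :: L, [], h => by simp at h
  | b :: L, c :: M, h => by
      simp only [List.flatMap_cons, List.append_assoc, List.singleton_append] at h
      have := terminator_cancel (hg b) (hk c) h
      simp [this.1, flatMap_terminator_cancel hg hk this.2]

theorem encodeBinary_injective : Function.Injective encodeBinary := by
  intro a b h
  have h' := (List.map_injective_iff.mpr fun x y h => by simpa using h) h
  exact Computability.encodingNatBool.encode_injective h'

theorem notMem_encodeBinary {k : ℕ} {s : GameSymbol} (hs : ∀ b, s ≠ .bit b) :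
    s ∉ encodeBinary k := by
  simp only [encodeBinary, List.mem_map, not_exists, not_and]
  exact fun b _ h => hs b h.symm

theorem notMem_encodeRat {q : ℚ} {s : GameSymbol} (hs : ∀ b, s ≠ .bit b) (h1 : s ≠ .minus)
    (h2 : s ≠ .slash) : s ∉ encodeRat q := by
  have := fun k => notMem_encodeBinary (k := k) hs
  unfold encodeRat
  split <;> simp [*]

theorem encodeRat_injective : Function.Injective encodeRat := by
  intro p q h
  have key : ∀ r : ℚ, GameSymbol.minus ∈ encodeRat r ↔ r < 0 := by
    intro r
    have := fun k => notMem_encodeBinary (k := k) (s := .minus) (by simp)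
    unfold encodeRat
    split <;> simp [*]
  have hs : p < 0 ↔ q < 0 := by rw [← key, ← key, h]
  have h' : encodeBinary p.num.natAbs ++ (GameSymbol.slash :: encodeBinary p.den) =
      encodeBinary q.num.natAbs ++ (GameSymbol.slash :: encodeBinary q.den) := by
    unfold encodeRat at h
    simp only [hs] at h
    exact List.append_cancel_left h
  obtain ⟨hn, hd⟩ := terminator_cancel (notMem_encodeBinary (by simp))
    (notMem_encodeBinary (by simp)) h'
  have hn := encodeBinary_injective hn
  have hd := encodeBinary_injective hd
  refine Rat.ext ?_ hd
  rw [← Rat.num_neg, ← Rat.num_neg] at hs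
  omega

theorem encodeGame_injective : Function.Injective encodeGame := by
  have hr : ∀ (r : ℚ), GameSymbol.comma ∉ encodeRat r := fun r =>
    notMem_encodeRat (by simp) (by simp) (by simp)
  have hrow : ∀ (I : StrictGame) (i : Fin I.n), GameSymbol.semicolon ∉
      (List.finRange I.n).flatMap fun j => encodeRat (I.game.value i j) ++ [GameSymbol.comma] := by
    intro I i
    have : ∀ (r : ℚ), GameSymbol.semicolon ∉ encodeRat r := fun r =>
      notMem_encodeRat (by simp) (by simp) (by simp)
    simp [this]
  rintro ⟨n, ⟨v⟩, hv⟩ ⟨m, ⟨w⟩, hw⟩ h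
  have h1 := flatMap_terminator_cancel (hrow ⟨n, ⟨v⟩, hv⟩) (hrow ⟨m, ⟨w⟩, hw⟩) h
  have hnm : n = m := by simpa using congrArg List.length h1
  subst hnm
  have : v = w := by
    funext i j
    have h2 := List.map_inj_left.mp h1 i (List.mem_finRange i)
    have h3 := flatMap_terminator_cancel (fun j => hr (v i j)) (fun j => hr (w i j)) h2
    exact encodeRat_injective (List.map_inj_left.mp h3 j (List.mem_finRange j))
  subst this
  rfl

theorem encodePartition_injective : Function.Injective encodePartition := by
  rintro ⟨n, π⟩ ⟨m, ρ⟩ h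
  have hrow : ∀ (n : ℕ) (π : Finpartition (Finset.univ : Finset (Fin n))) (i : Fin n),
      GameSymbol.semicolon ∉
        (List.finRange n).map (fun j => GameSymbol.bit (decide (j ∈ π.part i))) := by
    simp
  have h1 := flatMap_terminator_cancel (hrow n π) (hrow m ρ) h
  have least : ∀ (n : ℕ) (π : Finpartition (Finset.univ : Finset (Fin n))) (S : Finset (Fin n)),
      S ∈ π.parts ↔ ∃ i, (∀ j ∈ π.part i, i ≤ j) ∧ π.part i = S := by
    intro n π S
    constructor
    · intro hS
      have hne := π.nonempty_of_mem_parts hS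
      have e := π.part_eq_of_mem hS (S.min'_mem hne)
      exact ⟨S.min' hne, fun j hj => S.min'_le j (e ▸ hj), e⟩
    · rintro ⟨i, -, rfl⟩
      exact π.part_mem.mpr (Finset.mem_univ i)
  have hnm : n = m := by
    rcases Nat.eq_zero_or_pos n with rfl | hn
    · rcases Nat.eq_zero_or_pos m with rfl | hm
      · rfl
      · obtain ⟨i, hi, -⟩ := (least m ρ _).mp (ρ.part_mem.mpr (Finset.mem_univ ⟨0, hm⟩))
        have : (List.map (fun j => GameSymbol.bit (decide (j ∈ ρ.part i))) (List.finRange m)) ∈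
            ([] : List (List GameSymbol)) := by
          have h2 := h1.symm
          simp only [List.finRange_zero, List.filter_nil, List.map_nil] at h2
          rw [← h2]
          exact List.mem_map.mpr ⟨i, by simpa using hi, rfl⟩
        simp at this
    · obtain ⟨i, hi, -⟩ := (least n π _).mp (π.part_mem.mpr (Finset.mem_univ ⟨0, hn⟩))
      have : (List.map (fun j => GameSymbol.bit (decide (j ∈ π.part i))) (List.finRange n)) ∈
          List.map (fun i => List.map (fun j => GameSymbol.bit (decide (j ∈ ρ.part i)))
            (List.finRange m)) ((List.finRange m).filter fun i => ∀ j ∈ ρ.part i, i ≤ j) := by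
        rw [← h1]
        exact List.mem_map.mpr ⟨i, by simpa using hi, rfl⟩
      obtain ⟨k, -, hk⟩ := List.mem_map.mp this
      simpa using (congrArg List.length hk).symm
  subst hnm
  have sub : ∀ π ρ : Finpartition (Finset.univ : Finset (Fin n)),
      (((List.finRange n).filter fun i => ∀ j ∈ π.part i, i ≤ j).map fun i =>
        (List.finRange n).map (fun j => GameSymbol.bit (decide (j ∈ π.part i)))) =
      (((List.finRange n).filter fun i => ∀ j ∈ ρ.part i, i ≤ j).map fun i =>
        (List.finRange n).map (fun j => GameSymbol.bit (decide (j ∈ ρ.part i)))) →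
      π.parts ⊆ ρ.parts := by
    intro π ρ h S hS
    obtain ⟨i, hi, rfl⟩ := (least n π S).mp hS
    have hm : (List.finRange n).map (fun j => GameSymbol.bit (decide (j ∈ π.part i))) ∈
        (((List.finRange n).filter fun i => ∀ j ∈ π.part i, i ≤ j).map fun i =>
          (List.finRange n).map (fun j => GameSymbol.bit (decide (j ∈ π.part i)))) :=
      List.mem_map.mpr ⟨i, by simpa using hi, rfl⟩
    rw [h] at hm
    obtain ⟨k, -, hk⟩ := List.mem_map.mp hm
    have : ρ.part k = π.part i := by
      ext j
      simpa using List.map_inj_left.mp hk j (List.mem_finRange j)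
    exact this ▸ ρ.part_mem.mpr (Finset.mem_univ k)
  have : π = ρ := Finpartition.ext ((sub π ρ h1).antisymm (sub ρ π h1.symm))
  rw [this]

/-!
With strict preferences, the coalition that a dictator forms is her unique favourite among the sets
of remaining players that contain her. So if every player weakly prefers another partition to the
outcome of serial dictatorship, the coalition of the first dictator must be one of its parts, then
that of the second dictator, and so on: the two partitions agree.

A Turing machine asks the players in increasing order to be the dictator, which is the order of the
rows of the value matrix. It keeps a status for each column on a stack and decides the membership of
a player from the sign of a single entry, so each row is read only once. The row of a player who was
removed before her turn is marked in the log and dropped when the log is copied. Since a dictator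
is always the least remaining player, the coalitions appear in the order of their least members.
-/

theorem eq_filter_pos_of_sum_le {N R : Type*} [AddCommMonoid R] [LinearOrder R]
    [IsOrderedCancelAddMonoid R] {s t : Finset N} {f : N → R} (hst : s ⊆ t) (hf : ∀ i ∈ t, f i ≠ 0)
    (h : ∑ i ∈ t with 0 < f i, f i ≤ ∑ i ∈ s, f i) :
    s = {i ∈ t | 0 < f i} := by
  classical
  have hle : ∀ i ∈ t, (if i ∈ s then f i else 0) ≤ if 0 < f i then f i else 0 := by grind
  have hs : ∑ i ∈ s, f i = ∑ i ∈ t, if i ∈ s then f i else 0 := by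
    rw [← Finset.sum_filter, Finset.filter_mem_eq_inter, Finset.inter_eq_right.mpr hst]
  rw [Finset.sum_filter, hs] at h
  have heq := (Finset.sum_eq_sum_iff_of_le hle).mp ((Finset.sum_le_sum hle).antisymm h)
  ext i
  grind

namespace ASHG

section DictatorCoalition

variable {N R : Type*} [DecidableEq N] [AddCommMonoid R] [LinearOrder R] {G : ASHG N R}

theorem mem_dictatorCoalition {A : Finset N} {d j : N} :
    j ∈ G.dictatorCoalition A d ↔ j = d ∨ j ∈ A ∧ 0 < G.value d j := by
  simp [dictatorCoalition]

theorem self_mem_dictatorCoalition (G : ASHG N R) (A : Finset N) (d : N) :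
    d ∈ G.dictatorCoalition A d :=
  Finset.mem_insert_self _ _

theorem dictatorCoalition_subset (G : ASHG N R) {A : Finset N} {d : N} (hd : d ∈ A) :
    G.dictatorCoalition A d ⊆ A :=
  Finset.insert_subset hd (Finset.filter_subset _ _)

theorem SerialDictatorship.exists_finpartition {A : Finset N} {L : List (Finset N)}
    (hL : G.SerialDictatorship A L) : ∃ π : Finpartition A, π.parts = L.toFinset := by
  induction hL with
  | done => exact ⟨Finpartition.empty _, rfl⟩
  | step A d L hd _ ih =>
    obtain ⟨π, hπ⟩ := ih
    have hne : G.dictatorCoalition A d ≠ ⊥ := Finset.insert_ne_empty _ _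
    refine ⟨π.extend hne Finset.sdiff_disjoint
      (Finset.sdiff_union_of_subset (G.dictatorCoalition_subset hd)), ?_⟩
    rw [Finpartition.extend_parts, hπ, List.toFinset_cons]

end DictatorCoalition

section ParetoOptimality

variable {N R : Type*} [DecidableEq N] [AddCommMonoid R] [LinearOrder R]
  [IsOrderedCancelAddMonoid R] {G : ASHG N R}

theorem eq_dictatorCoalition_of_weakPref (hG : G.IsStrict) {A T : Finset N} {d : N} (hT : T ⊆ A)
    (hdT : d ∈ T) (h : G.WeakPref d T (G.dictatorCoalition A d)) :
    T = G.dictatorCoalition A d := by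
  have hliked : G.dictatorCoalition A d \ {d} = {j ∈ A \ {d} | 0 < G.value d j} := by
    grind [mem_dictatorCoalition]
  have hothers : T \ {d} = {j ∈ A \ {d} | 0 < G.value d j} := by
    refine eq_filter_pos_of_sum_le (by gcongr) (fun j hj => hG d j (by grind)) ?_
    simpa only [WeakPref, utility, hliked] using h
  calc T = insert d (T \ {d}) := by grind
    _ = insert d (G.dictatorCoalition A d \ {d}) := by rw [hothers, hliked]
    _ = G.dictatorCoalition A d := by grind [self_mem_dictatorCoalition]

theorem SerialDictatorship.part_eq_of_weakPref [Fintype N] (hG : G.IsStrict)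
    (π : Finpartition (Finset.univ : Finset N)) {A : Finset N} {L : List (Finset N)}
    (hL : G.SerialDictatorship A L) (hA : ∀ i ∈ A, π.part i ⊆ A)
    (hπ : ∀ S ∈ L, ∀ i ∈ S, G.WeakPref i (π.part i) S) :
    ∀ S ∈ L, ∀ i ∈ S, π.part i = S := by
  have mem_part : ∀ i, i ∈ π.part i := fun i => π.mem_part (Finset.mem_univ i)
  have part_eq : ∀ {i j}, j ∈ π.part i → π.part j = π.part i :=
    π.part_eq_of_mem (π.part_mem.mpr (Finset.mem_univ _))
  induction hL with
  | done => simp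
  | step A d L hd _ ih =>
    have hdictator : π.part d = G.dictatorCoalition A d :=
      eq_dictatorCoalition_of_weakPref hG (hA d hd) (mem_part d)
        (hπ _ List.mem_cons_self d (G.self_mem_dictatorCoalition A d))
    have hcoalition : ∀ i ∈ G.dictatorCoalition A d, π.part i = G.dictatorCoalition A d :=
      fun i hi => (part_eq (hdictator ▸ hi)).trans hdictator
    have hremaining : ∀ i ∈ A \ G.dictatorCoalition A d,
        π.part i ⊆ A \ G.dictatorCoalition A d := by
      intro i hi j hj
      grind
    rintro S (_ | ⟨_, hS⟩)
    · exact hcoalition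
    · exact ih hremaining (fun S hS => hπ S (List.mem_cons_of_mem _ hS)) S hS

theorem IsSerialDictatorshipOutcome.isParetoOptimal [Fintype N] (hG : G.IsStrict)
    {π : Finpartition (Finset.univ : Finset N)} (hπ : G.IsSerialDictatorshipOutcome π) :
    G.IsParetoOptimal π := by
  obtain ⟨L, hL, hLπ⟩ := hπ
  rintro ⟨π', hweak, j, -, hstrict⟩
  have mem_parts : ∀ {S}, S ∈ L ↔ S ∈ π.parts := by simp [← hLπ]
  have hpart := hL.part_eq_of_weakPref hG π' (fun i _ => Finset.subset_univ _) fun S hS i hi =>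
    π.part_eq_of_mem (mem_parts.mp hS) hi ▸ hweak i
  have hj : π'.part j = π.part j :=
    hpart _ (mem_parts.mpr (π.part_mem.mpr (Finset.mem_univ j))) j
      (π.mem_part (Finset.mem_univ j))
  exact hstrict (hj ▸ le_rfl)

end ParetoOptimality

section Turns

variable {N R : Type*} [DecidableEq N] [AddCommMonoid R] [LinearOrder R] {G : ASHG N R}

/-- The coalition formed when player `d` is asked while the players in `A` remain: her coalition
as the dictator if she remains herself, and `∅` otherwise. -/
def turnCoalition (G : ASHG N R) (A : Finset N) (d : N) : Finset N :=
  if d ∈ A then G.dictatorCoalition A d else ∅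

/-- The coalitions, possibly empty, that are formed when the players in a list are asked one after
the other and the players in `A` remain at the start. -/
def turnCoalitions (G : ASHG N R) : List N → Finset N → List (Finset N)
  | [], _ => []
  | d :: L, A => G.turnCoalition A d :: turnCoalitions G L (A \ G.turnCoalition A d)

theorem mem_turnCoalition {A : Finset N} {d j : N} :
    j ∈ G.turnCoalition A d ↔ d ∈ A ∧ (j = d ∨ j ∈ A ∧ 0 < G.value d j) := by
  unfold turnCoalition
  split_ifs with hd <;> simp [hd, mem_dictatorCoalition]

theorem turnCoalition_subset (G : ASHG N R) (A : Finset N) (d : N) :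
    G.turnCoalition A d ⊆ A := by
  grind [mem_turnCoalition]

theorem turnCoalition_nonempty {A : Finset N} {d : N} :
    (G.turnCoalition A d).Nonempty ↔ d ∈ A :=
  ⟨fun ⟨_, hj⟩ => (mem_turnCoalition.mp hj).1, fun hd => ⟨d, mem_turnCoalition.mpr ⟨hd, .inl rfl⟩⟩⟩

theorem mem_of_mem_sdiff_turnCoalition {A : Finset N} {d : N} {L : List N}
    (hA : ∀ j ∈ A, j ∈ d :: L) : ∀ j ∈ A \ G.turnCoalition A d, j ∈ L := by
  grind [mem_turnCoalition]

@[simp]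
theorem length_turnCoalitions (G : ASHG N R) (L : List N) (A : Finset N) :
    (G.turnCoalitions L A).length = L.length := by
  induction L generalizing A with
  | nil => rfl
  | cons d L ih => rw [turnCoalitions, List.length_cons, ih, List.length_cons]

theorem serialDictatorship_turnCoalitions {L : List N} {A : Finset N} (hA : ∀ j ∈ A, j ∈ L) :
    G.SerialDictatorship A ((G.turnCoalitions L A).filter (·.Nonempty)) := by
  induction L generalizing A with
  | nil =>
    obtain rfl : A = ∅ := Finset.eq_empty_of_forall_notMem fun j hj => by simpa using hA j hj
    exact .done
  | cons d L ih =>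
    have hrest := ih (mem_of_mem_sdiff_turnCoalition (G := G) hA)
    by_cases hd : d ∈ A
    · rw [turnCoalitions, List.filter_cons_of_pos (by simpa [turnCoalition_nonempty])]
      simp only [turnCoalition, hd, if_true] at hrest ⊢
      exact .step A d _ hd hrest
    · simpa [turnCoalitions, turnCoalition, hd] using hrest

theorem subset_of_mem_turnCoalitions {L : List N} {A S : Finset N}
    (hS : S ∈ G.turnCoalitions L A) : S ⊆ A := by
  induction L generalizing A with
  | nil => simp [turnCoalitions] at hS
  | cons d L ih =>
    rcases List.mem_cons.mp hS with rfl | hS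
    · exact G.turnCoalition_subset A d
    · exact (ih hS).trans Finset.sdiff_subset

end Turns

end ASHG

section Encoding

/-- Some member of `S` is smaller than every member of `T`. On nonempty finite sets of players this
says that the least member of `S` is smaller than that of `T`. -/
def LeastPrecedes {N : Type*} [Preorder N] (S T : Finset N) : Prop :=
  ∃ i ∈ S, ∀ j ∈ T, i < j

instance {N : Type*} [Preorder N] : Std.Irrefl (LeastPrecedes (N := N)) where
  irrefl _ := fun ⟨i, hi, hlt⟩ => lt_irrefl i (hlt i hi)

instance {N : Type*} [Preorder N] : Std.Antisymm (LeastPrecedes (N := N)) where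
  antisymm _ _ := fun ⟨i, hi, hlt⟩ ⟨j, hj, hgt⟩ => ((hlt j hj).asymm (hgt i hi)).elim

theorem ASHG.pairwise_leastPrecedes_turnCoalitions {N R : Type*} [DecidableEq N] [Preorder N]
    [AddCommMonoid R] [LinearOrder R] (G : ASHG N R) {L : List N} (hL : L.Pairwise (· < ·))
    {A : Finset N} (hA : ∀ j ∈ A, j ∈ L) :
    ((G.turnCoalitions L A).filter (·.Nonempty)).Pairwise LeastPrecedes := by
  induction L generalizing A with
  | nil => exact .nil
  | cons d L ih =>
    obtain ⟨hd, hL⟩ := List.pairwise_cons.mp hL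
    have hrest := mem_of_mem_sdiff_turnCoalition (G := G) hA
    rw [turnCoalitions, List.filter_cons]
    split_ifs with hne
    · have hdA : d ∈ A := turnCoalition_nonempty.mp (by simpa using hne)
      refine .cons (fun T hT => ⟨d, mem_turnCoalition.mpr ⟨hdA, .inl rfl⟩, fun j hj => ?_⟩)
        (ih hL hrest)
      exact hd j (hrest j (subset_of_mem_turnCoalitions (List.mem_of_mem_filter hT) hj))
    · exact ih hL hrest

/-- The code of a coalition: its characteristic bit vector on the players in `J`, followed by a
semicolon. -/
def encodeCoalition {N : Type*} [DecidableEq N] (J : List N) (S : Finset N) : List GameSymbol :=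
  J.map (fun j => .bit (decide (j ∈ S))) ++ [.semicolon]

theorem encodePartition_eq_flatMap_encodeCoalition {n : ℕ}
    (π : Finpartition (Finset.univ : Finset (Fin n))) {L : List (Finset (Fin n))}
    (hL : L.Pairwise LeastPrecedes) (hLπ : π.parts = L.toFinset) :
    encodePartition ⟨n, π⟩ = L.flatMap (encodeCoalition (List.finRange n)) := by
  have mem_part : ∀ i, i ∈ π.part i := fun i => π.mem_part (Finset.mem_univ i)
  set leaders := (List.finRange n).filter fun i => ∀ j ∈ π.part i, i ≤ j with hleaders
  have hsorted : (leaders.map π.part).Pairwise LeastPrecedes := by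
    refine List.pairwise_map.mpr
      (((List.pairwise_lt_finRange n).filter _).imp_of_mem fun {i k} _ hk hik => ?_)
    have hk : ∀ j ∈ π.part k, k ≤ j := by simpa [hleaders] using hk
    exact ⟨i, mem_part i, fun j hj => hik.trans_le (hk j hj)⟩
  have hparts : ∀ S, S ∈ leaders.map π.part ↔ S ∈ L := by
    intro S
    rw [← List.mem_toFinset (l := L), ← hLπ, List.mem_map]
    constructor
    · rintro ⟨i, -, rfl⟩
      exact π.part_mem.mpr (Finset.mem_univ i)
    · intro hS
      have hne := π.nonempty_of_mem_parts hS
      have hpart := π.part_eq_of_mem hS (S.min'_mem hne)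
      exact ⟨S.min' hne, by simpa [hleaders, hpart] using fun j hj => S.min'_le j hj, hpart⟩
  rw [← hsorted.eq_of_mem_iff hL hparts, List.flatMap_map]
  rfl

end Encoding

theorem ASHG.exists_outcome_turnCoalitions {R : Type*} [AddCommMonoid R] [LinearOrder R] {n : ℕ}
    (G : ASHG (Fin n) R) : ∃ π : Finpartition (Finset.univ : Finset (Fin n)),
      G.IsSerialDictatorshipOutcome π ∧ encodePartition ⟨n, π⟩ =
        ((G.turnCoalitions (List.finRange n) Finset.univ).filter (·.Nonempty)).flatMap
          (encodeCoalition (List.finRange n)) := by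
  have hrun : G.SerialDictatorship Finset.univ _ :=
    serialDictatorship_turnCoalitions (L := List.finRange n) (by simp)
  obtain ⟨π, hπ⟩ := hrun.exists_finpartition
  exact ⟨π, ⟨_, hrun, hπ.symm⟩, encodePartition_eq_flatMap_encodeCoalition π
    (G.pairwise_leastPrecedes_turnCoalitions (List.pairwise_lt_finRange n) (by simp)) hπ⟩

/-- The iteration of `f` passes from `a` to `b` in at most `t` steps. -/
def ReachesInTime {σ : Type*} (f : σ → Option σ) (t : ℕ) (a b : σ) : Prop :=
  Nonempty (StateTransition.EvalsToInTime f a (some b) t)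

namespace ReachesInTime

variable {σ : Type*} {f : σ → Option σ} {s t : ℕ} {a b c : σ}

theorem refl (a : σ) : ReachesInTime f 0 a a :=
  ⟨.refl f a⟩

theorem single (h : f a = some b) : ReachesInTime f 1 a b :=
  ⟨⟨⟨1, h⟩, le_rfl⟩⟩

theorem trans (hab : ReachesInTime f s a b) (hbc : ReachesInTime f t b c) :
    ReachesInTime f (s + t) a c :=
  add_comm t s ▸ ⟨.trans f s t a b (some c) hab.some hbc.some⟩

theorem head (hab : f a = some b) (hbc : ReachesInTime f t b c) : ReachesInTime f (t + 1) a c :=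
  add_comm 1 t ▸ (single hab).trans hbc

theorem mono (h : ReachesInTime f s a b) (hst : s ≤ t) : ReachesInTime f t a b :=
  ⟨⟨h.some.toEvalsTo, h.some.steps_le_m.trans hst⟩⟩

end ReachesInTime

namespace SerialMachine

open Turing

section Machine

/-- What the machine knows about a player before it reads a row: her own row has been read
already, or it has not but she is in one of the coalitions formed so far, or neither. -/
inductive Status
  | past
  | taken
  | free
  deriving DecidableEq

instance : Fintype Status where
  elems := {.past, .taken, .free}
  complete s := by cases s <;> decide

/-- The position in a row: before the diagonal entry, or behind it in the row of a dictator, or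
behind it in the row of a player who was removed before her turn. In the writing phase `skip` says
that the current row of the log is dropped. -/
inductive Mode
  | before
  | active
  | skip
  deriving DecidableEq

instance : Fintype Mode where
  elems := {.before, .active, .skip}
  complete s := by cases s <;> decide

/-- The effect of a matrix entry: from the mode, the status of the column, and whether the entry is
nonnegative, the next mode, the new status, and whether the player of the column joins the
coalition of the row. -/
def entry : Mode → Status → Bool → Mode × Status × Bool
  | .before, .past, _ => (.before, .past, false)
  | .before, .taken, _ => (.skip, .past, false)
  | .before, .free, _ => (.active, .past, true)
  | .active, .free, true => (.active, .taken, true)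
  | .active, s, _ => (.active, s, false)
  | .skip, s, _ => (.skip, s, false)

/-- The stacks of the machine. The statuses of the columns are on `todo` and `done`, to the right
and to the left of the current entry; `log` collects the rows of the result. -/
inductive Stack
  | input
  | todo
  | done
  | log
  | output
  deriving DecidableEq

instance : Fintype Stack where
  elems := {.input, .todo, .done, .log, .output}
  complete s := by cases s <;> decide

/-- The alphabets of the stacks. -/
def Alphabet : Stack → Type
  | .todo | .done => Status
  | .input | .log | .output => GameSymbol

/-- The labels of the program: read a separator or the first symbol of an entry, pass over the rest
of an entry, move the statuses back at the end of a row, discard them at the end of the input, and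
copy the log to the output. -/
inductive Label
  | scan
  | advance
  | restore
  | clear
  | write
  deriving DecidableEq

instance : Fintype Label where
  elems := {.scan, .advance, .restore, .clear, .write}
  complete s := by cases s <;> decide

/-- The internal states of the machine: the mode, and the results of the last pop from a stack of
symbols and from a stack of statuses. -/
structure State where
  mode : Mode
  symbol : Option GameSymbol := none
  status : Option Status := none
  deriving Fintype

/-- The effect of the current entry, whose sign shows in its first symbol. A missing status counts
as `free`, since `todo` is empty when the first row is read. -/
def State.entry (v : State) : Mode × Status × Bool :=
  SerialMachine.entry v.mode (v.status.getD .free) (v.symbol ≠ some .minus)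

/-- The separator that ends a row of the log; a comma marks the rows that will be dropped. -/
def rowEnd : Mode → GameSymbol
  | .skip => .comma
  | .before | .active => .semicolon

/-- End a step: pass to the label `l` with a new mode, forgetting the last pops. -/
def resume (l : Label) (mode : State → Mode) : TM2.Stmt Alphabet Label State :=
  .load (fun v => { mode := mode v }) (.goto fun _ => l)

/-- The program of the machine. -/
def program : Label → TM2.Stmt Alphabet Label State
  | .scan =>
    .pop .input (fun v x => { v with symbol := x }) <|
    .branch (fun v => v.symbol = none) (resume .clear fun _ => .before) <|
    .branch (fun v => v.symbol = some .semicolon)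
      (.push .log (fun v => rowEnd v.mode) <| resume .restore fun _ => .before) <|
    .pop .todo (fun v s => { v with status := s }) <|
    .push .done (fun v => v.entry.2.1) <|
    .push .log (fun v => .bit v.entry.2.2) <|
    resume .advance fun v => v.entry.1
  | .advance =>
    .pop .input (fun v x => { v with symbol := x }) <|
    .branch (fun v => v.symbol = some .comma) (resume .scan State.mode) <|
    resume .advance State.mode
  | .restore =>
    .pop .done (fun v s => { v with status := s }) <|
    .branch (fun v => v.status = none) (resume .scan State.mode) <|
    .push .todo (fun v => v.status.getD .free) <|
    resume .restore State.mode
  | .clear =>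
    .pop .todo (fun v s => { v with status := s }) <|
    .branch (fun v => v.status = none) (resume .write State.mode) <|
    resume .clear State.mode
  | .write =>
    .pop .log (fun v x => { v with symbol := x }) <|
    .branch (fun v => v.symbol = none) (.load (fun _ => { mode := .before }) .halt) <|
    .branch (fun v => v.symbol = some .comma) (resume .write fun _ => .skip) <|
    .branch (fun v => v.symbol = some .semicolon)
      (.push .output (fun _ => .semicolon) <| resume .write fun _ => .active) <|
    .branch (fun v => v.mode = .skip) (resume .write State.mode) <|
    .push .output (fun v => v.symbol.getD .semicolon) <|
    resume .write State.mode

/-- The machine that asks the players in increasing order to be the dictator. -/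
def machine : FinTM2 where
  K := Stack
  k₀ := .input
  k₁ := .output
  Γ := Alphabet
  Λ := Label
  main := .scan
  σ := State
  initialState := { mode := .before }
  Γk₀Fin := inferInstanceAs (Fintype GameSymbol)
  m := program

/-- The configuration between two steps with the given label, mode and stacks. -/
def cfg (l : Option Label) (m : Mode) (inp : List GameSymbol) (todo done : List Status)
    (log out : List GameSymbol) : machine.Cfg where
  l := l
  var := { mode := m }
  stk
    | .input => inp
    | .todo => todo
    | .done => done
    | .log => log
    | .output => out

end Machine

section Steps

variable {m : Mode} {inp : List GameSymbol} {todo done : List Status} {log out : List GameSymbol}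

theorem some_cfg_ext {l : Option Label} {v : State} {S T : ∀ k, List (Alphabet k)}
    (h : ∀ k, S k = T k) :
    (some ⟨l, v, S⟩ : Option (TM2.Cfg Alphabet Label State)) = some ⟨l, v, T⟩ := by
  rw [funext h]

theorem step_scan_nil : machine.step (cfg (some .scan) m [] todo done log out) =
    some (cfg (some .clear) .before [] todo done log out) :=
  some_cfg_ext (by rintro (_ | _) <;> rfl)

theorem step_scan_semicolon :
    machine.step (cfg (some .scan) m (.semicolon :: inp) todo done log out) =
      some (cfg (some .restore) .before inp todo done (rowEnd m :: log) out) :=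
  some_cfg_ext (by rintro (_ | _) <;> rfl)

theorem step_scan_of_ne_semicolon {x : GameSymbol} (hx : x ≠ .semicolon) :
    machine.step (cfg (some .scan) m (x :: inp) todo done log out) =
      let r := entry m (todo.headD .free) (x ≠ .minus)
      some (cfg (some .advance) r.1 inp todo.tail (r.2.1 :: done) (.bit r.2.2 :: log) out) := by
  cases x <;> cases todo <;> first
    | exact absurd rfl hx
    | exact some_cfg_ext (by rintro (_ | _) <;> rfl)

theorem step_advance_comma :
    machine.step (cfg (some .advance) m (.comma :: inp) todo done log out) =
      some (cfg (some .scan) m inp todo done log out) :=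
  some_cfg_ext (by rintro (_ | _) <;> rfl)

theorem step_advance_of_ne_comma {x : GameSymbol} (hx : x ≠ .comma) :
    machine.step (cfg (some .advance) m (x :: inp) todo done log out) =
      some (cfg (some .advance) m inp todo done log out) := by
  cases x <;> first
    | exact absurd rfl hx
    | exact some_cfg_ext (by rintro (_ | _) <;> rfl)

theorem step_restore_nil : machine.step (cfg (some .restore) m inp todo [] log out) =
    some (cfg (some .scan) m inp todo [] log out) :=
  some_cfg_ext (by rintro (_ | _) <;> rfl)

theorem step_restore_cons {s : Status} :
    machine.step (cfg (some .restore) m inp todo (s :: done) log out) =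
      some (cfg (some .restore) m inp (s :: todo) done log out) :=
  some_cfg_ext (by rintro (_ | _) <;> rfl)

theorem step_clear_nil : machine.step (cfg (some .clear) m inp [] done log out) =
    some (cfg (some .write) m inp [] done log out) :=
  some_cfg_ext (by rintro (_ | _) <;> rfl)

theorem step_clear_cons {s : Status} :
    machine.step (cfg (some .clear) m inp (s :: todo) done log out) =
      some (cfg (some .clear) m inp todo done log out) :=
  some_cfg_ext (by rintro (_ | _) <;> rfl)

theorem step_write_nil : machine.step (cfg (some .write) m inp todo done [] out) =
    some (cfg none .before inp todo done [] out) :=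
  some_cfg_ext (by rintro (_ | _) <;> rfl)

theorem step_write_comma :
    machine.step (cfg (some .write) m inp todo done (.comma :: log) out) =
      some (cfg (some .write) .skip inp todo done log out) :=
  some_cfg_ext (by rintro (_ | _) <;> rfl)

theorem step_write_semicolon :
    machine.step (cfg (some .write) m inp todo done (.semicolon :: log) out) =
      some (cfg (some .write) .active inp todo done log (.semicolon :: out)) :=
  some_cfg_ext (by rintro (_ | _) <;> rfl)

theorem step_write_bit_skip {b : Bool} :
    machine.step (cfg (some .write) .skip inp todo done (.bit b :: log) out) =
      some (cfg (some .write) .skip inp todo done log out) :=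
  some_cfg_ext (by rintro (_ | _) <;> rfl)

theorem step_write_bit_active {b : Bool} :
    machine.step (cfg (some .write) .active inp todo done (.bit b :: log) out) =
      some (cfg (some .write) .active inp todo done log (.bit b :: out)) :=
  some_cfg_ext (by rintro (_ | _) <;> rfl)

end Steps

section Phases

variable {inp : List GameSymbol} {todo done : List Status} {log out : List GameSymbol}

theorem reaches_advance {m : Mode} {w : List GameSymbol} (hw : .comma ∉ w) :
    ReachesInTime machine.step (w.length + 1)
      (cfg (some .advance) m (w ++ .comma :: inp) todo done log out)
      (cfg (some .scan) m inp todo done log out) := by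
  induction w with
  | nil => exact .single step_advance_comma
  | cons x w ih =>
    obtain ⟨hx, hw⟩ := List.ne_and_not_mem_of_not_mem_cons hw
    exact .head (step_advance_of_ne_comma hx.symm) (ih hw)

theorem reaches_restore {m : Mode} :
    ReachesInTime machine.step (done.length + 1) (cfg (some .restore) m inp todo done log out)
      (cfg (some .scan) m inp (done.reverse ++ todo) [] log out) := by
  induction done generalizing todo with
  | nil => exact .single step_restore_nil
  | cons s done ih =>
    rw [List.reverse_cons, List.append_assoc]
    exact .head step_restore_cons ih

theorem reaches_clear {m : Mode} :
    ReachesInTime machine.step (todo.length + 1) (cfg (some .clear) m inp todo done log out)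
      (cfg (some .write) m inp [] done log out) := by
  induction todo with
  | nil => exact .single step_clear_nil
  | cons s todo ih => exact .head step_clear_cons ih

theorem reaches_write_skip (bits : List Bool) :
    ReachesInTime machine.step bits.length
      (cfg (some .write) .skip inp todo done (bits.map .bit ++ log) out)
      (cfg (some .write) .skip inp todo done log out) := by
  induction bits with
  | nil => exact .refl _
  | cons b bits ih => exact .head step_write_bit_skip ih

theorem reaches_write_active (bits : List Bool) :
    ReachesInTime machine.step bits.length
      (cfg (some .write) .active inp todo done (bits.map .bit ++ log) out)
      (cfg (some .write) .active inp todo done log ((bits.map .bit).reverse ++ out)) := by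
  induction bits generalizing out with
  | nil => exact .refl _
  | cons b bits ih =>
    rw [List.map_cons, List.reverse_cons, List.append_assoc]
    exact .head step_write_bit_active ih

end Phases

section Reading

theorem encodeRat_eq_cons (q : ℚ) : ∃ x w, encodeRat q = x :: w ∧ x ≠ .semicolon ∧ .comma ∉ w ∧
    (x ≠ .minus ↔ 0 ≤ q) := by
  have hcomma : .comma ∉ encodeRat q := notMem_encodeRat (by simp) (by simp) (by simp)
  have hsemicolon : .semicolon ∉ encodeRat q := notMem_encodeRat (by simp) (by simp) (by simp)
  have hminus : .minus ∉ encodeBinary q.num.natAbs ++ .slash :: encodeBinary q.den := by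
    simp [notMem_encodeBinary]
  rcases h : encodeRat q with _ | ⟨x, w⟩
  · simp [encodeRat] at h
  rw [h] at hcomma hsemicolon
  refine ⟨x, w, rfl, by grind, by grind, ?_⟩
  unfold encodeRat at h
  split_ifs at h with hq <;> grind

variable {inp : List GameSymbol} {todo done : List Status} {log out : List GameSymbol}

theorem reaches_entry {m : Mode} (q : ℚ) :
    let r := entry m (todo.headD .free) (0 ≤ q)
    ReachesInTime machine.step ((encodeRat q).length + 1)
      (cfg (some .scan) m (encodeRat q ++ .comma :: inp) todo done log out)
      (cfg (some .scan) r.1 inp todo.tail (r.2.1 :: done) (.bit r.2.2 :: log) out) := by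
  obtain ⟨x, w, h, hx, hw, hsign⟩ := encodeRat_eq_cons q
  simp only [h, ← hsign]
  exact .head (step_scan_of_ne_semicolon hx) (reaches_advance hw)

/-- The effect of a sequence of matrix entries: from the mode and the status and sign of every
column, the final mode and the new status and membership bit of every column. -/
def scanRow : Mode → List (Status × Bool) → Mode × List (Status × Bool)
  | m, [] => (m, [])
  | m, (s, b) :: l =>
    let r := entry m s b
    let t := scanRow r.1 l
    (t.1, r.2 :: t.2)

theorem scanRow_append (m : Mode) (l l' : List (Status × Bool)) :
    scanRow m (l ++ l') =
      ((scanRow (scanRow m l).1 l').1, (scanRow m l).2 ++ (scanRow (scanRow m l).1 l').2) := by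
  induction l generalizing m with
  | nil => rfl
  | cons p l ih => simp only [List.cons_append, scanRow, ih]

theorem scanRow_map_of_entry {α : Type*} {m : Mode} {J : List α} {p q : α → Status × Bool}
    (h : ∀ j ∈ J, entry m (p j).1 (p j).2 = (m, q j)) :
    scanRow m (J.map p) = (m, J.map q) := by
  induction J with
  | nil => rfl
  | cons j J ih =>
    obtain ⟨hj, hJ⟩ := List.forall_mem_cons.mp h
    simp only [List.map_cons, scanRow, hj, ih hJ]

/-- The code of a row of the value matrix: the values `v j` of the players in `J`, each followed by
a comma, and a final semicolon. -/
def encodeRow {N : Type*} (J : List N) (v : N → ℚ) : List GameSymbol :=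
  (J.flatMap fun j => encodeRat (v j) ++ [.comma]) ++ [.semicolon]

theorem length_lt_length_encodeRow {N : Type*} (J : List N) (v : N → ℚ) :
    J.length < (encodeRow J v).length := by
  simp [encodeRow]

theorem headD_eq_and_tail_rightpad_eq {α : Type*} {a b : α} {l l' : List α} {n : ℕ}
    (h : l.rightpad (n + 1) a = b :: l') : l.headD a = b ∧ l.tail.rightpad n a = l' := by
  cases l <;> simpa [List.replicate_succ] using h

theorem reaches_scanRow {N : Type*} {m : Mode} {J : List N} {s : N → Status} (v : N → ℚ)
    (htodo : todo.rightpad J.length .free = J.map s) :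
    let r := scanRow m (J.map fun j => (s j, decide (0 ≤ v j)))
    ReachesInTime machine.step (encodeRow J v).length
      (cfg (some .scan) m (encodeRow J v ++ inp) todo done log out)
      (cfg (some .restore) .before inp [] ((r.2.map Prod.fst).reverse ++ done)
        (rowEnd r.1 :: (r.2.map fun p => .bit p.2).reverse ++ log) out) := by
  induction J generalizing m todo done log with
  | nil =>
    obtain rfl : todo = [] := by simpa using htodo
    exact .single step_scan_semicolon
  | cons j J ih =>
    obtain ⟨hhead, htail⟩ := headD_eq_and_tail_rightpad_eq htodo
    have hcode : encodeRow (j :: J) v = encodeRat (v j) ++ .comma :: encodeRow J v := by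
      simp [encodeRow]
    have hentry := reaches_entry (m := m) (inp := encodeRow J v ++ inp) (todo := todo)
      (done := done) (log := log) (out := out) (v j)
    rw [hhead] at hentry
    simpa [hcode, scanRow, add_assoc, add_comm 1] using hentry.trans (ih htail)

end Reading

section Rows

variable {N R : Type*} [DecidableEq N]

/-- The status of player `j` when the rows of the players in `L` are still to be read and the
players in `A` remain. -/
def status (L : List N) (A : Finset N) (j : N) : Status :=
  if j ∈ A then .free else if j ∈ L then .taken else .past

section Entries

variable [AddCommMonoid R] [LinearOrder R] {G : ASHG N R} {A : Finset N} {i j : N} {L : List N}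

theorem entry_before_status (hA : ∀ j ∈ A, j ∈ i :: L) (hj : j ∉ i :: L) (b : Bool) :
    entry .before (status (i :: L) A j) b =
      (.before, status L (A \ G.turnCoalition A i) j, decide (j ∈ G.turnCoalition A i)) := by
  have hjA : j ∉ A := fun h => hj (hA j h)
  have hjC : j ∉ G.turnCoalition A i := fun h => hjA (G.turnCoalition_subset A i h)
  have hjL : j ∉ L := fun h => hj (List.mem_cons_of_mem i h)
  simp [status, entry, hj, hjA, hjC, hjL]

theorem entry_before_status_self (hi : i ∉ L) (b : Bool) :
    entry .before (status (i :: L) A i) b =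
      (if i ∈ A then .active else .skip, status L (A \ G.turnCoalition A i) i,
        decide (i ∈ G.turnCoalition A i)) := by
  by_cases hiA : i ∈ A <;> simp [status, entry, ASHG.mem_turnCoalition, hi, hiA]

theorem entry_status_of_mem (hG : G.IsStrict) (hi : i ∉ L) (hj : j ∈ L) :
    entry (if i ∈ A then .active else .skip) (status (i :: L) A j) (0 ≤ G.value i j) =
      (if i ∈ A then .active else .skip, status L (A \ G.turnCoalition A i) j,
        decide (j ∈ G.turnCoalition A i)) := by
  have hij : j ≠ i := ne_of_mem_of_not_mem hj hi
  have hsign : 0 ≤ G.value i j ↔ 0 < G.value i j := (hG i j hij.symm).symm.le_iff_lt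
  by_cases hiA : i ∈ A <;> by_cases hjA : j ∈ A <;> by_cases hpos : 0 < G.value i j <;>
    simp [status, entry, ASHG.mem_turnCoalition, *]

theorem scanRow_status (hG : G.IsStrict) {P : List N} (hJ : (P ++ i :: L).Nodup)
    (hA : ∀ j ∈ A, j ∈ i :: L) :
    scanRow .before ((P ++ i :: L).map fun j => (status (i :: L) A j, decide (0 ≤ G.value i j))) =
      (if i ∈ A then .active else .skip, (P ++ i :: L).map fun j =>
        (status L (A \ G.turnCoalition A i) j, decide (j ∈ G.turnCoalition A i))) := by
  obtain ⟨-, hiL, hdisjoint⟩ := List.nodup_append'.mp hJ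
  have hi := (List.nodup_cons.mp hiL).1
  let p j := (status (i :: L) A j, decide (0 ≤ G.value i j))
  have hbefore := scanRow_map_of_entry (p := p) fun j hj =>
    entry_before_status (G := G) hA (hdisjoint hj) (0 ≤ G.value i j)
  have hafter := scanRow_map_of_entry (p := p) fun j hj =>
    entry_status_of_mem (A := A) hG hi hj
  simp only [p] at hbefore hafter
  simp only [List.map_append, List.map_cons, scanRow_append, hbefore, scanRow,
    entry_before_status_self (G := G) hi, hafter]

end Entries

/-- The row of the log for the coalition `S`: its characteristic bit vector, followed by a
semicolon, or by a comma if the row is to be dropped because `S` is empty. -/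
def logRow (J : List N) (S : Finset N) : List GameSymbol :=
  J.map (fun j => .bit (decide (j ∈ S))) ++ [if S.Nonempty then .semicolon else .comma]

variable {G : ASHG N ℚ} {A : Finset N} {inp : List GameSymbol} {todo done : List Status}
  {log out : List GameSymbol}

theorem reaches_encodeRow (hG : G.IsStrict) {P L : List N} {i : N} (hJ : (P ++ i :: L).Nodup)
    (hA : ∀ j ∈ A, j ∈ i :: L)
    (htodo : todo.rightpad (P ++ i :: L).length .free = (P ++ i :: L).map (status (i :: L) A)) :
    ReachesInTime machine.step (2 * (encodeRow (P ++ i :: L) (G.value i)).length)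
      (cfg (some .scan) .before (encodeRow (P ++ i :: L) (G.value i) ++ inp) todo [] log out)
      (cfg (some .scan) .before inp
        ((P ++ i :: L).map (status L (A \ G.turnCoalition A i))) []
        ((logRow (P ++ i :: L) (G.turnCoalition A i)).reverse ++ log) out) := by
  have hrow := (reaches_scanRow (m := .before) (inp := inp) (done := []) (log := log) (out := out)
    (G.value i) htodo).trans reaches_restore
  have hlen := length_lt_length_encodeRow (P ++ i :: L) (G.value i)
  have hend : rowEnd (if i ∈ A then .active else .skip) =
      if (G.turnCoalition A i).Nonempty then .semicolon else .comma := by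
    simp only [ASHG.turnCoalition_nonempty]
    split_ifs <;> rfl
  rw [scanRow_status hG hJ hA, hend] at hrow
  generalize P ++ i :: L = J at *
  simpa [logRow, Function.comp_def] using hrow.mono (t := 2 * _) (by simp; omega)

theorem reaches_rows (hG : G.IsStrict) {J P L : List N} (hJ : J.Nodup) (hPL : J = P ++ L)
    (hA : ∀ j ∈ A, j ∈ L) (htodo : todo.rightpad J.length .free = J.map (status L A)) :
    ∃ todo' : List Status, todo'.length ≤ J.length ∧
      ReachesInTime machine.step (2 * (L.flatMap fun i => encodeRow J (G.value i)).length)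
        (cfg (some .scan) .before (L.flatMap fun i => encodeRow J (G.value i)) todo [] log out)
        (cfg (some .scan) .before [] todo' []
          (((G.turnCoalitions L A).flatMap (logRow J)).reverse ++ log) out) := by
  induction L generalizing P A todo log with
  | nil =>
    have hlen : todo.length ≤ J.length := by
      have := congrArg List.length htodo
      simp at this
      omega
    exact ⟨todo, hlen, .refl _⟩
  | cons i L ih =>
    subst hPL
    have hrow := reaches_encodeRow (out := out) (log := log)
      (inp := L.flatMap fun k => encodeRow (P ++ i :: L) (G.value k)) hG hJ hA htodo
    obtain ⟨todo', hlen, hrows⟩ := ih (P := P ++ [i])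
      (todo := (P ++ i :: L).map (status L (A \ G.turnCoalition A i))) (by simp)
      (ASHG.mem_of_mem_sdiff_turnCoalition (G := G) hA) (by simp)
    exact ⟨todo', hlen, by simpa [ASHG.turnCoalitions, mul_add] using hrow.trans hrows⟩

end Rows

section Writing

variable {N : Type*} [DecidableEq N] {inp : List GameSymbol} {todo done : List Status}
  {log out : List GameSymbol}

theorem reaches_write_logRow (m : Mode) (J : List N) (S : Finset N) :
    ∃ m', ReachesInTime machine.step (J.length + 1)
      (cfg (some .write) m inp todo done ((logRow J S).reverse ++ log) out)
      (cfg (some .write) m' inp todo done log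
        ((if S.Nonempty then encodeCoalition J S else []) ++ out)) := by
  let bits := (J.map fun j => decide (j ∈ S)).reverse
  have hlog : (logRow J S).reverse =
      (if S.Nonempty then .semicolon else .comma) :: bits.map .bit := by
    simp [bits, logRow, Function.comp_def]
  have hcode : encodeCoalition J S ++ out = (bits.map .bit).reverse ++ .semicolon :: out := by
    simp [bits, encodeCoalition, Function.comp_def]
  have hlen : bits.length = J.length := by simp [bits]
  rw [hlog, ← hlen]
  split_ifs
  · exact ⟨.active, hcode ▸ .head step_write_semicolon (reaches_write_active bits)⟩
  · exact ⟨.skip, .head step_write_comma (reaches_write_skip bits)⟩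

theorem reaches_write (m : Mode) (J : List N) (Ss : List (Finset N)) :
    ∃ m', ReachesInTime machine.step (Ss.length * (J.length + 1))
      (cfg (some .write) m inp todo done ((Ss.flatMap (logRow J)).reverse ++ log) out)
      (cfg (some .write) m' inp todo done log
        ((Ss.filter (·.Nonempty)).flatMap (encodeCoalition J) ++ out)) := by
  induction Ss generalizing log m with
  | nil => exact ⟨m, by simpa using ReachesInTime.refl _⟩
  | cons S Ss ih =>
    obtain ⟨m₁, hSs⟩ := ih (log := (logRow J S).reverse ++ log) m
    obtain ⟨m₂, hS⟩ := reaches_write_logRow m₁ J S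
    have h := hSs.trans hS
    refine ⟨m₂, ?_⟩
    by_cases hne : S.Nonempty <;> simpa [hne, add_mul] using h

end Writing

section Computation

theorem initList_machine (w : List GameSymbol) :
    initList machine w = cfg (some .scan) .before w [] [] [] [] := by
  unfold initList cfg
  congr 1
  funext k
  cases k <;> rfl

theorem haltList_machine (w : List GameSymbol) :
    haltList machine w = cfg none .before [] [] [] [] w := by
  unfold haltList cfg
  congr 1
  funext k
  cases k <;> rfl

theorem mul_length_succ_le_length_flatMap_encodeRow {N : Type*} (J : List N) (v : N → N → ℚ) :
    J.length * (J.length + 1) ≤ (J.flatMap fun i => encodeRow J (v i)).length := by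
  have hrow : ∀ k ∈ J.map fun i => (encodeRow J (v i)).length, J.length + 1 ≤ k := by
    simpa [Nat.succ_le_iff] using fun i _ => length_lt_length_encodeRow J (v i)
  simpa [List.length_flatMap] using List.card_nsmul_le_sum _ _ hrow

theorem reaches_output {N : Type*} [DecidableEq N] {G : ASHG N ℚ} (hG : G.IsStrict) {J : List N}
    (hJ : J.Nodup) :
    ReachesInTime machine.step (4 * (J.flatMap fun i => encodeRow J (G.value i)).length + 3)
      (cfg (some .scan) .before (J.flatMap fun i => encodeRow J (G.value i)) [] [] [] [])
      (cfg none .before [] [] [] [] (((G.turnCoalitions J J.toFinset).filter (·.Nonempty)).flatMap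
        (encodeCoalition J))) := by
  have hfree : J.map (status J J.toFinset) = List.replicate J.length .free :=
    List.map_eq_replicate_iff.mpr (by simp +contextual [status])
  obtain ⟨todo, htodo, hread⟩ := reaches_rows (P := []) (A := J.toFinset) (todo := []) (log := [])
    (out := []) hG hJ rfl (by simp) hfree.symm
  obtain ⟨m, hwrite⟩ := reaches_write (inp := []) (todo := []) (done := []) (log := []) (out := [])
    .before J (G.turnCoalitions J J.toFinset)
  have hcode := mul_length_succ_le_length_flatMap_encodeRow J G.value
  rw [ASHG.length_turnCoalitions] at hwrite
  simp only [List.append_nil] at hread hwrite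
  have h := (hread.trans (.head step_scan_nil reaches_clear)).trans
    (hwrite.trans (.single step_write_nil))
  exact h.mono (by nlinarith)

theorem exists_linearTime_computation
    (f : (I : StrictGame) → Finpartition (Finset.univ : Finset (Fin I.n)))
    (hf : ∀ I, encodePartition ⟨I.n, f I⟩ =
      ((I.game.turnCoalitions (List.finRange I.n) Finset.univ).filter (·.Nonempty)).flatMap
        (encodeCoalition (List.finRange I.n))) :
    ∃ M : TM2ComputableInPolyTime encodeGame encodePartition fun I : StrictGame => ⟨I.n, f I⟩,
      M.time.natDegree ≤ 1 := by
  have hrun : ∀ I : StrictGame, ReachesInTime machine.step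
      ((4 * Polynomial.X + 3 : Polynomial ℕ).eval (encodeGame I).length)
      (initList machine (encodeGame I)) (haltList machine (encodePartition ⟨I.n, f I⟩)) := by
    intro I
    rw [initList_machine, haltList_machine, hf]
    have hgame : encodeGame I = (List.finRange I.n).flatMap fun i =>
        encodeRow (List.finRange I.n) (I.game.value i) := rfl
    simpa [-List.length_flatMap, ← hgame] using
      reaches_output I.strict (List.nodup_finRange I.n)
  refine ⟨{ tm := machine
            inputAlphabet := Equiv.refl GameSymbol
            outputAlphabet := Equiv.refl GameSymbol
            time := 4 * Polynomial.X + 3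
            outputsFun := fun I => ?_ }, ?_⟩
  · erw [List.map_id, List.map_id]
    exact (hrun I).some
  · change (4 * Polynomial.X + 3 : Polynomial ℕ).natDegree ≤ 1
    compute_degree!

end Computation

end SerialMachine

theorem mainTheorem2_general :
    (∀ (N R : Type*) [Fintype N] [DecidableEq N] [AddCommMonoid R] [LinearOrder R]
      [IsOrderedCancelAddMonoid R] (G : ASHG N R), G.IsStrict →
      ∀ π : Finpartition (Finset.univ : Finset N),
        G.IsSerialDictatorshipOutcome π → G.IsParetoOptimal π) ∧
    ∃ f : (I : StrictGame) → Finpartition (Finset.univ : Finset (Fin I.n)),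
      (∃ M : Turing.TM2ComputableInPolyTime encodeGame encodePartition
        fun I : StrictGame => ⟨I.n, f I⟩, M.time.natDegree ≤ 1) ∧
      ∀ I : StrictGame,
        I.game.IsSerialDictatorshipOutcome (f I) ∧ I.game.IsParetoOptimal (f I) := by
  choose f houtcome hcode using fun I : StrictGame => I.game.exists_outcome_turnCoalitions
  exact ⟨fun _ _ _ _ _ _ _ _ hG _ hπ => hπ.isParetoOptimal hG, f,
    SerialMachine.exists_linearTime_computation f hcode,
    fun I => ⟨houtcome I, (houtcome I).isParetoOptimal I.strict⟩⟩

theorem mainTheorem2 :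
    (∀ (N : Type*) [Fintype N] [DecidableEq N] (G : ASHG N ℝ), G.IsStrict →
      ∀ π : Finpartition (Finset.univ : Finset N),
        G.IsSerialDictatorshipOutcome π → G.IsParetoOptimal π) ∧
    ∃ f : (I : StrictGame) → Finpartition (Finset.univ : Finset (Fin I.n)),
      Nonempty (Turing.TM2ComputableInPolyTime encodeGame encodePartition
        fun I : StrictGame => ⟨I.n, f I⟩) ∧
      ∀ I : StrictGame,
        I.game.IsSerialDictatorshipOutcome (f I) ∧ I.game.IsParetoOptimal (f I) :=
  let ⟨h, f, ⟨M, _⟩, hf⟩ := mainTheorem2_general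
  ⟨fun N _ _ => h N ℝ, f, ⟨M⟩, hf⟩
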